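/- Let $X$ be a regular Hausdorff topological space and let $\mathcal N=(N_e)_{e\in\omega}$ be a countable cs-network for $X$: whenever a sequence $(x_n)_{n\in\omega}$ converges to a point $x$ of an open set $U\subseteq X$, there are $e,n_0\in\omega$ with $\{x\}\cup\{x_n:n\ge n_0\}\subseteq N_e\subseteq U$. A name of a point $z\in X$ is any $p\in\omega^\omega$ such that $\{N_{p(n)}:n\in\omega\}$ is a strict network at $z$, that is, $z\in N_{p(n)}$ for all $n$, and every open neighborhood of $z$ includes $N_{p(n)}$ for some $n$. Let $GH_e$ be the $e$-th (lightface) $\Sigma^1_1$ subset of Baire space $\omega^\omega$, that is, $GH_e=\{x:\exists y\in\omega^\omega\ \forall n\ (x\upharpoonright n,y\upharpoonright n)\notin W_e\}$, where $W_e$ is the $e$-th computably enumerable set of pairs of finite words over $\omega$. The Gandy–Harrington space $(\omega^\omega)_{GH}$ is $\omega^\omega$ with the topology generated by $(GH_e)_{e\in\omega}$; a name of a point $x\in(\omega^\omega)_{GH}$ is any $p\in\omega^\omega$ with range $\{e\in\omega:x\in GH_e\}$. For $P,Q\subseteq\omega^\omega$, $P$ is Medvedev reducible to $Q$ if some partial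 computable function on $\omega^\omega$ is defined on all of $Q$ and maps $Q$ into $P$. The degree of a point is the Medvedev degree of its set of names; write $\mathcal D_{(\omega^\omega)_{GH}}$ and $\mathcal D_{(X,\mathcal N)}$ for the sets of degrees of points of $(\omega^\omega)_{GH}$ and of $X$. Then $$\mathcal D_{(\omega^\omega)_{GH}}\not\subseteq\mathcal D_{(X,\mathcal N)},$$ that is, there is $x\in\omega^\omega$ such that for no $z\in X$ the set of names of $x$ is Medvedev equivalent to the set of names of $z$. -/

import Mathlib

open Filter Topology

/-! ### Medvedev reducibility on Baire space -/

/-- The initial segment of length `s` of a point of Baire space. -/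
def initSeg (p : ℕ → ℕ) (s : ℕ) : List ℕ := (List.range s).map p

/-- The word function `φ` maps `q` to `p` in the limit: every initial segment of `p` is an initial
segment of the output of `φ` on some initial segment of `q`. -/
def MapsInLimit (φ : List ℕ → List ℕ) (q p : ℕ → ℕ) : Prop :=
  ∀ n, ∃ s, initSeg p n <+: φ (initSeg q s)

/-- Medvedev reducibility `P ≤ Q` of subsets of Baire space: some partial computable function on
Baire space is defined on all of `Q` and maps `Q` into `P`.  A partial computable function on
Baire space is given by a computable word function which is monotone for the prefix order; it is
defined at `q` when the outputs on the initial segments of `q` become arbitrarily long, and its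
value is their union. -/
def MedvedevLE (P Q : Set (ℕ → ℕ)) : Prop :=
  ∃ φ : List ℕ → List ℕ, Computable φ ∧ (∀ σ τ, σ <+: τ → φ σ <+: φ τ) ∧
    ∀ q ∈ Q, ∃ p ∈ P, MapsInLimit φ q p

theorem MedvedevLE.refl (P : Set (ℕ → ℕ)) : MedvedevLE P P :=
  ⟨id, Computable.id, fun _ _ h => h, fun q hq => ⟨q, hq, fun n => ⟨n, List.prefix_refl _⟩⟩⟩

theorem MedvedevLE.trans {P Q R : Set (ℕ → ℕ)} (h₁ : MedvedevLE P Q) (h₂ : MedvedevLE Q R) :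
    MedvedevLE P R := by
  obtain ⟨φ, hφ, mφ, hPQ⟩ := h₁
  obtain ⟨ψ, hψ, mψ, hQR⟩ := h₂
  refine ⟨fun σ => φ (ψ σ), hφ.comp hψ, fun σ τ h => mφ _ _ (mψ _ _ h), fun r hr => ?_⟩
  obtain ⟨q, hq, hrq⟩ := hQR r hr
  obtain ⟨p, hp, hqp⟩ := hPQ q hq
  refine ⟨p, hp, fun n => ?_⟩
  obtain ⟨s, hs⟩ := hqp n
  obtain ⟨t, ht⟩ := hrq s
  exact ⟨t, hs.trans (mφ _ _ ht)⟩

/-- Medvedev equivalence. -/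
def medvedevSetoid : Setoid (Set (ℕ → ℕ)) where
  r P Q := MedvedevLE P Q ∧ MedvedevLE Q P
  iseqv :=
    { refl := fun P => ⟨MedvedevLE.refl P, MedvedevLE.refl P⟩
      symm := fun h => ⟨h.2, h.1⟩
      trans := fun h k => ⟨h.1.trans k.1, k.2.trans h.2⟩ }

/-- The Medvedev degrees. -/
def MedvedevDegree : Type := Quotient medvedevSetoid

/-- The Medvedev degree of a subset of Baire space. -/
def medvedevDegree (P : Set (ℕ → ℕ)) : MedvedevDegree := Quotient.mk medvedevSetoid P

/-- The set of all degrees of points of a space, where `name x` is the set of names of the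
point `x` and the degree of `x` is the Medvedev degree of `name x`. -/
def pointDegrees {X : Type*} (name : X → Set (ℕ → ℕ)) : Set MedvedevDegree :=
  Set.range fun x => medvedevDegree (name x)

/-! ### The Gandy-Harrington space -/

/-- The coded neighborhood filter of `x` with respect to a countable subbasis `β`. -/
def codedNbhdFilter {X : Type*} (β : ℕ → Set X) (x : X) : Set ℕ := {e | x ∈ β e}

/-- The names of `x` with respect to a countable subbasis `β`: all enumerations of the coded
neighborhood filter of `x`. -/
def basisNames {X : Type*} (β : ℕ → Set X) (x : X) : Set (ℕ → ℕ) :=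
  {p | Set.range p = codedNbhdFilter β x}

/-- The `e`-th computably enumerable set of pairs of words: the pairs on which the `e`-th
partial recursive function is defined. -/
def cePairs (e : ℕ) : Set (List ℕ × List ℕ) :=
  {w | ((Denumerable.ofNat Nat.Partrec.Code e).eval (Encodable.encode w)).Dom}

/-- The `e`-th (lightface) `Σ¹₁` subset of Baire space: the projection of the `e`-th `Π⁰₁` subset
of the product of two copies of Baire space. These sets generate the Gandy-Harrington topology. -/
def gandyHarrington (e : ℕ) : Set (ℕ → ℕ) :=
  {x | ∃ y : ℕ → ℕ, ∀ n, (initSeg x n, initSeg y n) ∉ cePairs e}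

/-! ### Networks -/

/-- A family of sets is a network at `x` if every open neighborhood of `x` includes a member of
the family which contains `x`. -/
def IsNetworkAt {X : Type*} [TopologicalSpace X] (𝒩 : Set (Set X)) (x : X) : Prop :=
  ∀ U : Set X, IsOpen U → x ∈ U → ∃ A ∈ 𝒩, x ∈ A ∧ A ⊆ U

/-- A network at `x` is strict if all of its members contain `x`. -/
def IsStrictNetworkAt {X : Type*} [TopologicalSpace X] (𝒩 : Set (Set X)) (x : X) : Prop :=
  IsNetworkAt 𝒩 x ∧ ∀ A ∈ 𝒩, x ∈ A

/-- A cs-network (convergent sequence network) of a topological space. -/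
def IsCsNetwork {X : Type*} [TopologicalSpace X] (𝒩 : Set (Set X)) : Prop :=
  ∀ (U : Set X), IsOpen U → ∀ (u : ℕ → X) (x : X), x ∈ U → Tendsto u atTop (𝓝 x) →
    ∃ A ∈ 𝒩, ∃ n₀ : ℕ, {x} ∪ {y | ∃ n ≥ n₀, y = u n} ⊆ A ∧ A ⊆ U

/-- The names of `x` with respect to a countable cs-network `N`: all sequences of indices which
enumerate a strict network at `x`. -/
def networkNames {X : Type*} [TopologicalSpace X] (N : ℕ → Set X) (x : X) : Set (ℕ → ℕ) :=
  {p | IsStrictNetworkAt (Set.range fun n => N (p n)) x}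

/-!
The space `X` enters through a regularity argument only. Suppose that every point of the
Gandy-Harrington space has the degree of a point of `X`. For each of the countably many pairs of
computable functions which can witness a Medvedev equivalence, consider the set `Z` of all points
`x` whose names are matched with the names of some `f x : X` by this pair. Then `f : Z → X` is
continuous, and its inverse is sequentially continuous because `X` has a cs-network; as `X` is
regular, so is the subspace `Z` (`exists_finset_closure_subset_of_matchedPoints`). It remains to
see that the Gandy-Harrington space is not a countable union of regular subspaces
(`exists_forall_closure_not_subset_gandyHarrington`).

For this, points of Baire space are read as forests on `ℕ`, and a version of Steel's forcing with
tagged trees is used. A condition is a finite forest whose nodes carry labels, ordinals or `⊤`,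
which decrease strictly along ordinals; in a generic forest there is an infinite branch from
a node if and only if its label is `⊤`. By a category argument, the generic points of one of the sets `Z` are
dense below some condition `A`. Choose a generic `x ∈ Z` below `A` in which a new node `n` has label
`⊤`, so that `x` is in the `Σ¹₁` set `U` of all forests with a branch from `n`, and let `V ∋ x` be
open, forced by a condition `p`. Replace the label `⊤` of the new nodes in `p` by large ordinals
`≥ δ`, and let `y ∈ Z` be generic below the resulting condition; then `y ∉ U`. If `W ∋ y` is
`Σ¹₁`, forced by `q`, then replacing all labels `≥ δ` in `q` by `⊤` gives a condition below `p`
which still forces `W`, so that `V ∩ W` meets `Z`. Hence `y` is in the closure of `V` in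
`Z`, and `Z` is not regular at `x`.

The last claim about `W` is a consequence of retagging (`ForestCond.exists_le_sim`,
`ForestCond.ForcesRankLE.of_sim`): whether a condition forces the tree of attempts to show `y ∈ W`
to have rank `≤ γ` depends only on its labels below an ordinal computed from `γ`. An ordinal `δ` is
large enough if it is closed under the least ranks that can be forced below conditions with labels
`< δ` or `⊤` (`ForestCond.exists_isReflecting`). As ranks are compared with labels, it is convenient
to allow all ordinals as labels; although they form a proper class, the same closure argument
shows that a well-founded tree has a forced rank (`ForestCond.exists_forcesRankLE`).
-/

/-! ### Names in the two kinds of spaces -/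

theorem length_initSeg (p : ℕ → ℕ) (n : ℕ) : (initSeg p n).length = n := by
  simp [initSeg]

theorem initSeg_succ (p : ℕ → ℕ) (n : ℕ) : initSeg p (n + 1) = initSeg p n ++ [p n] := by
  simp [initSeg, List.range_succ]

theorem initSeg_congr {p q : ℕ → ℕ} {n : ℕ} (h : ∀ i < n, p i = q i) :
    initSeg p n = initSeg q n :=
  List.map_congr_left fun i hi => h i (List.mem_range.1 hi)

theorem initSeg_prefix (p : ℕ → ℕ) {m n : ℕ} (h : m ≤ n) : initSeg p m <+: initSeg p n := by
  induction n, h using Nat.le_induction with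
  | base => exact List.prefix_refl _
  | succ n _ ih => exact ih.trans (initSeg_succ p n ▸ List.prefix_append _ _)

/-- Continuity of the function on Baire space given by a monotone word function: a value already
determined by an initial segment `initSeg q s` is shared by all inputs with this initial segment. -/
theorem MapsInLimit.apply_eq {φ : List ℕ → List ℕ} (mφ : ∀ σ τ, σ <+: τ → φ σ <+: φ τ)
    {q q' p p' : ℕ → ℕ} (h' : MapsInLimit φ q' p') {k s : ℕ}
    (hs : initSeg p (k + 1) <+: φ (initSeg q s)) (hq : initSeg q' s = initSeg q s) :
    p' k = p k := by
  obtain ⟨t, ht⟩ := h' (k + 1)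
  have h1 : initSeg p' (k + 1) <+: φ (initSeg q' (max s t)) :=
    ht.trans (mφ _ _ (initSeg_prefix q' (le_max_right s t)))
  have h2 : initSeg p (k + 1) <+: φ (initSeg q' (max s t)) :=
    (hs.trans (by rw [hq])).trans (mφ _ _ (initSeg_prefix q' (le_max_left s t)))
  have h3 : initSeg p' (k + 1) = initSeg p (k + 1) :=
    (List.prefix_of_prefix_length_le h1 h2 (by simp [length_initSeg])).eq_of_length
      (by simp [length_initSeg])
  rw [initSeg_succ, initSeg_succ] at h3
  simpa using (List.append_inj' h3 rfl).2

/-- Every finite word over a nonempty set of numbers extends to an enumeration of the set. -/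
theorem exists_range_eq_initSeg_eq {S : Set ℕ} (hS : S.Nonempty) {q : ℕ → ℕ} {s : ℕ}
    (hq : ∀ i < s, q i ∈ S) : ∃ q' : ℕ → ℕ, Set.range q' = S ∧ initSeg q' s = initSeg q s := by
  obtain ⟨g, hg⟩ := S.to_countable.exists_eq_range hS
  refine ⟨fun i => if i < s then q i else g (i - s), ?_, initSeg_congr fun i hi => by simp [hi]⟩
  apply Set.Subset.antisymm
  · rintro _ ⟨i, rfl⟩
    by_cases hi : i < s
    · simpa [hi] using hq i hi
    · simp [hi, hg]
  · rw [hg]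
    rintro _ ⟨i, rfl⟩
    exact ⟨i + s, by simp⟩

section Networks

variable {X : Type*} [TopologicalSpace X] {N : ℕ → Set X}

/-- The limit of a convergent sequence has a name all of whose members contain almost all terms of
the sequence. This is the only use of the cs-network property besides the existence of names. -/
theorem exists_mem_networkNames_eventually (hN : IsCsNetwork (Set.range N)) {u : ℕ → X} {z : X}
    (hu : Tendsto u atTop (𝓝 z)) :
    ∃ q ∈ networkNames N z, ∀ i, ∀ᶠ n in atTop, u n ∈ N (q i) := by
  set S : Set ℕ := {e | z ∈ N e ∧ ∀ᶠ n in atTop, u n ∈ N e} with hS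
  have key : ∀ U : Set X, IsOpen U → z ∈ U → ∃ e ∈ S, N e ⊆ U := by
    intro U hU hz
    obtain ⟨_, ⟨e, rfl⟩, n₀, hsub, hAU⟩ := hN U hU u z hz hu
    refine ⟨e, ⟨hsub (Or.inl rfl), ?_⟩, hAU⟩
    filter_upwards [eventually_ge_atTop n₀] with n hn
    exact hsub (Or.inr ⟨n, hn, rfl⟩)
  have hne : S.Nonempty := by
    obtain ⟨e, he, -⟩ := key Set.univ isOpen_univ (Set.mem_univ z)
    exact ⟨e, he⟩
  obtain ⟨q, hq⟩ := S.to_countable.exists_eq_range hne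
  have hmem : ∀ i, q i ∈ S := fun i => hq ▸ Set.mem_range_self i
  refine ⟨q, ⟨fun U hU hz => ?_, ?_⟩, fun i => (hmem i).2⟩
  · obtain ⟨e, he, heU⟩ := key U hU hz
    obtain ⟨i, rfl⟩ : e ∈ Set.range q := hq ▸ he
    exact ⟨_, ⟨i, rfl⟩, he.1, heU⟩
  · rintro _ ⟨i, rfl⟩
    exact (hmem i).1

theorem exists_mem_networkNames_initSeg_eq (hN : IsCsNetwork (Set.range N)) {z : X} {q : ℕ → ℕ}
    {s : ℕ} (hq : ∀ i < s, z ∈ N (q i)) :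
    ∃ q' ∈ networkNames N z, initSeg q' s = initSeg q s := by
  obtain ⟨r, hr, -⟩ := exists_mem_networkNames_eventually hN (tendsto_const_nhds (x := z))
  obtain ⟨q', hq', hs⟩ := exists_range_eq_initSeg_eq (S := {e | z ∈ N e})
    ⟨r 0, hr.2 _ ⟨0, rfl⟩⟩ hq
  refine ⟨q', ⟨fun U hU hz => ?_, ?_⟩, hs⟩
  · obtain ⟨_, ⟨i, rfl⟩, hi, hiU⟩ := hr.1 U hU hz
    obtain ⟨j, hj⟩ : r i ∈ Set.range q' := hq' ▸ hi
    exact ⟨_, ⟨j, rfl⟩, by simpa only [hj] using hi, by simpa only [hj] using hiU⟩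
  · rintro _ ⟨i, rfl⟩
    have : q' i ∈ {e | z ∈ N e} := hq' ▸ Set.mem_range_self i
    exact this

/-- The points of a space with countable subbasis `β` whose sets of names are Medvedev equivalent
to the set of names of some point of `X`, as witnessed by the word functions `φ` and `ψ`. -/
def matchedPoints {Y : Type*} (β : ℕ → Set Y) (N : ℕ → Set X) (φ ψ : List ℕ → List ℕ) : Set Y :=
  {x | ∃ z : X, (∀ q ∈ basisNames β x, ∃ p ∈ networkNames N z, MapsInLimit φ q p) ∧
    ∀ q ∈ networkNames N z, ∃ p ∈ basisNames β x, MapsInLimit ψ q p}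

/-- If `X` is regular, then a subspace of a second countable space which is matched with points of
`X` by a fixed pair of continuous functions on names is regular. Closures in the subspace `Z` are
spelled out in terms of the subbasis. The map from `Z` to `X` is continuous and its inverse is
sequentially continuous, by the cs-network; so a sequence of points in the closures of shrinking
neighborhoods of `x`, which is mapped to a convergent sequence by regularity of `X`, converges. -/
theorem exists_finset_closure_subset_of_matchedPoints [RegularSpace X] {Y : Type*} {β : ℕ → Set Y}
    (hβ : ∀ y, ∃ e, y ∈ β e) (hN : IsCsNetwork (Set.range N)) {φ ψ : List ℕ → List ℕ}
    (mφ : ∀ σ τ, σ <+: τ → φ σ <+: φ τ) (mψ : ∀ σ τ, σ <+: τ → ψ σ <+: ψ τ)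
    {x : Y} (hx : x ∈ matchedPoints β N φ ψ) {e : ℕ} (hxe : x ∈ β e) :
    ∃ F : Finset ℕ, (∀ i ∈ F, x ∈ β i) ∧ ∀ y ∈ matchedPoints β N φ ψ,
      (∀ F' : Finset ℕ, (∀ i ∈ F', y ∈ β i) →
        ∃ w ∈ matchedPoints β N φ ψ, (∀ i ∈ F, w ∈ β i) ∧ ∀ i ∈ F', w ∈ β i) → y ∈ β e := by
  classical
  have hmatch : ∀ y : matchedPoints β N φ ψ, ∃ z : X,
      (∀ q ∈ basisNames β y.1, ∃ p ∈ networkNames N z, MapsInLimit φ q p) ∧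
      ∀ q ∈ networkNames N z, ∃ p ∈ basisNames β y.1, MapsInLimit ψ q p := fun y => y.2
  choose f hf hf' using hmatch
  have hcont : ∀ (y : matchedPoints β N φ ψ) (U : Set X), IsOpen U → f y ∈ U →
      ∃ F : Finset ℕ, (∀ i ∈ F, y.1 ∈ β i) ∧
        ∀ w : matchedPoints β N φ ψ, (∀ i ∈ F, w.1 ∈ β i) → f w ∈ U := by
    intro y U hU hyU
    obtain ⟨q, hq, -⟩ := exists_range_eq_initSeg_eq (S := codedNbhdFilter β y.1) (hβ y)
      (q := id) (s := 0) (by simp)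
    obtain ⟨p, hp, hqp⟩ := hf y q hq
    obtain ⟨_, ⟨k, rfl⟩, -, hkU⟩ := hp.1 U hU hyU
    obtain ⟨s, hs⟩ := hqp (k + 1)
    refine ⟨(Finset.range s).image q, ?_, fun w hw => ?_⟩
    · intro i hi
      obtain ⟨j, -, rfl⟩ := Finset.mem_image.1 hi
      have : q j ∈ codedNbhdFilter β y.1 := hq ▸ Set.mem_range_self j
      exact this
    · obtain ⟨q', hq', hs'⟩ := exists_range_eq_initSeg_eq (S := codedNbhdFilter β w.1) (hβ w)
        (q := q) (s := s) (fun i hi => hw _ (Finset.mem_image_of_mem _ (Finset.mem_range.2 hi)))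
      obtain ⟨p', hp', hqp'⟩ := hf w q' hq'
      have := hqp'.apply_eq mφ hs hs'
      exact hkU (by simpa only [this] using hp'.2 _ ⟨k, rfl⟩)
  by_contra! hcon
  set V : ℕ → Finset ℕ := fun n => (Finset.range n).filter fun i => x ∈ β i with hV
  have hVx : ∀ n, ∀ i ∈ V n, x ∈ β i := fun n i hi => (Finset.mem_filter.1 hi).2
  choose y hyZ hycl hye using fun n => hcon (V n) (hVx n)
  set x' : matchedPoints β N φ ψ := ⟨x, hx⟩ with hx'
  set y' : ℕ → matchedPoints β N φ ψ := fun n => ⟨y n, hyZ n⟩ with hy'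
  have htend : Tendsto (fun n => f (y' n)) atTop (𝓝 (f x')) := by
    rw [(closed_nhds_basis (f x')).tendsto_right_iff]
    rintro C ⟨hC, hCcl⟩
    obtain ⟨U, hUC, hU, hxU⟩ := mem_nhds_iff.1 hC
    obtain ⟨F, hF, hFU⟩ := hcont x' U hU hxU
    filter_upwards [eventually_ge_atTop (F.sup id + 1)] with n hn
    by_contra hnC
    obtain ⟨F', hF', hFU'⟩ := hcont (y' n) Cᶜ hCcl.isOpen_compl hnC
    obtain ⟨w, hw, hwV, hwF'⟩ := hycl n F' hF'
    refine hFU' ⟨w, hw⟩ hwF' (hUC (hFU ⟨w, hw⟩ fun i hi => hwV i ?_))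
    exact Finset.mem_filter.2 ⟨Finset.mem_range.2
      ((Nat.lt_succ_of_le (Finset.le_sup (f := id) hi)).trans_le hn), hF i hi⟩
  obtain ⟨q, hq, hqev⟩ := exists_mem_networkNames_eventually hN htend
  obtain ⟨p, hp, hqp⟩ := hf' x' q hq
  obtain ⟨k, hk⟩ : e ∈ Set.range p := hp ▸ hxe
  obtain ⟨s, hs⟩ := hqp (k + 1)
  have hev : ∀ᶠ n in atTop, ∀ i ∈ Finset.range s, f (y' n) ∈ N (q i) :=
    (Finset.eventually_all _).2 fun i _ => hqev i
  obtain ⟨n, hn⟩ := hev.exists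
  obtain ⟨q', hq', hs'⟩ := exists_mem_networkNames_initSeg_eq hN
    (fun i hi => hn i (Finset.mem_range.2 hi))
  obtain ⟨p', hp', hqp'⟩ := hf' (y' n) q' hq'
  have hpk : p' k = p k := hqp'.apply_eq mψ hs hs'
  have : p' k ∈ codedNbhdFilter β (y n) := hp' ▸ Set.mem_range_self k
  rw [hpk, hk] at this
  exact hye n this

end Networks

/-! ### Infinite branches of forests form a `Σ¹₁` set -/

theorem exists_cePairs_eq {R : List ℕ × List ℕ → Prop} (hR : REPred R) :
    ∃ e, cePairs e = {w | R w} := by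
  obtain ⟨c, hc⟩ := Nat.Partrec.Code.exists_code.1 hR
  refine ⟨Encodable.encode c, Set.ext fun w => ?_⟩
  rw [cePairs, Set.mem_ofPred_eq, Denumerable.ofNat_encode, hc]
  simp only [Encodable.encodek, Part.coe_some, Part.bind_some, Part.map_Dom]
  simp [Part.assert]

/-- A point `x` of Baire space codes a forest on `ℕ`, in which `x j` is the parent of `j` if
`x j < j`, and `j` is a root otherwise. `HasBranch x n` says that there is an infinite branch of the
forest starting at `n`. -/
def HasBranch (x : ℕ → ℕ) (n : ℕ) : Prop :=
  ∃ y : ℕ → ℕ, y 0 = n ∧ ∀ k, y k < y (k + 1) ∧ x (y (k + 1)) = y k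

/-- Two words refute that the second one is an initial segment of a branch starting at `n`, in a
forest which has the first one as initial segment. -/
def RefutesBranch (n : ℕ) (w : List ℕ × List ℕ) : Prop :=
  (∃ k < w.2.length, k = 0 ∧ w.2.getD k 0 ≠ n) ∨
    ∃ k < w.2.length, 0 < k ∧ w.2.getD k 0 < w.1.length ∧
      ¬ (w.2.getD (k - 1) 0 < w.2.getD k 0 ∧ w.1.getD (w.2.getD k 0) 0 = w.2.getD (k - 1) 0)

theorem primrecPred_refutesBranch (n : ℕ) : PrimrecPred (RefutesBranch n) := by
  have l1 : Primrec fun v : ℕ × (List ℕ × List ℕ) => v.2.1 := Primrec.fst.comp Primrec.snd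
  have l2 : Primrec fun v : ℕ × (List ℕ × List ℕ) => v.2.2 := Primrec.snd.comp Primrec.snd
  have hlen : Primrec fun w : List ℕ × List ℕ => w.2.length :=
    Primrec.list_length.comp Primrec.snd
  have a : Primrec fun v : ℕ × (List ℕ × List ℕ) => v.2.2.getD v.1 0 :=
    (Primrec.list_getD 0).comp l2 Primrec.fst
  have b : Primrec fun v : ℕ × (List ℕ × List ℕ) => v.2.2.getD (v.1 - 1) 0 :=
    (Primrec.list_getD 0).comp l2 (Primrec.nat_sub.comp Primrec.fst (Primrec.const 1))
  have c : Primrec fun v : ℕ × (List ℕ × List ℕ) => v.2.1.getD (v.2.2.getD v.1 0) 0 :=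
    (Primrec.list_getD 0).comp l1 a
  have h1 : PrimrecRel fun (k : ℕ) (w : List ℕ × List ℕ) => k = 0 ∧ w.2.getD k 0 ≠ n :=
    (Primrec.eq.comp Primrec.fst (Primrec.const 0)).and
      (Primrec.eq.comp a (Primrec.const n)).not
  have h2 : PrimrecRel fun (k : ℕ) (w : List ℕ × List ℕ) => 0 < k ∧
      w.2.getD k 0 < w.1.length ∧ ¬ (w.2.getD (k - 1) 0 < w.2.getD k 0 ∧
        w.1.getD (w.2.getD k 0) 0 = w.2.getD (k - 1) 0) :=
    (Primrec.nat_lt.comp (Primrec.const 0) Primrec.fst).and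
      ((Primrec.nat_lt.comp a (Primrec.list_length.comp l1)).and
        ((Primrec.nat_lt.comp b a).and (Primrec.eq.comp c b)).not)
  have hrange := Primrec.list_range.comp hlen
  exact ((h1.exists_mem_list.comp hrange Primrec.id).or
    (h2.exists_mem_list.comp hrange Primrec.id)).of_eq fun w => by simp [RefutesBranch]

theorem getD_initSeg {x : ℕ → ℕ} {m i : ℕ} (h : i < m) : (initSeg x m).getD i 0 = x i := by
  simp [initSeg, List.getD, h]

theorem exists_gandyHarrington_eq_hasBranch (n : ℕ) :
    ∃ e, gandyHarrington e = {x | HasBranch x n} := by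
  obtain ⟨e, he⟩ := exists_cePairs_eq
    (ComputablePred.to_re (primrecPred_refutesBranch n).computablePred)
  refine ⟨e, Set.ext fun x => exists_congr fun y => ?_⟩
  have hlen : ∀ m, (initSeg x m).length = m ∧ (initSeg y m).length = m := by simp [initSeg]
  simp only [he, Set.mem_ofPred_eq, RefutesBranch, hlen]
  constructor
  · intro h
    refine ⟨?_, fun k => ?_⟩
    · by_contra hne
      exact h 1 (Or.inl ⟨0, one_pos, rfl, by rwa [getD_initSeg one_pos]⟩)
    · by_contra hne
      -- an initial segment long enough to contain both `k + 1` and `y (k + 1)`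
      have hk : k + 1 < k + 2 + y (k + 1) := by omega
      refine h (k + 2 + y (k + 1)) (Or.inr ⟨k + 1, hk, k.succ_pos, ?_⟩)
      rw [getD_initSeg hk, Nat.add_sub_cancel, getD_initSeg (by omega), getD_initSeg (by omega)]
      exact ⟨by omega, hne⟩
  · rintro ⟨h0, h1⟩ m (⟨k, hk, rfl, hne⟩ | ⟨k, hk, hpos, hlt, hne⟩)
    · exact hne (by rw [getD_initSeg hk, h0])
    · obtain ⟨k, rfl⟩ := Nat.exists_eq_add_of_lt hpos
      rw [getD_initSeg hk] at hlt hne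
      rw [getD_initSeg (by omega), getD_initSeg hlt] at hne
      simp only [Nat.zero_add, Nat.add_sub_cancel] at hne
      exact hne (by simpa using h1 k)

theorem exists_gandyHarrington_eq_univ : ∃ e, gandyHarrington e = Set.univ := by
  obtain ⟨e, he⟩ := exists_cePairs_eq (R := fun _ => (0 : ℕ) = 1) (ComputablePred.to_re
    (Primrec.eq.comp (Primrec.const 0) (Primrec.const 1)).computablePred)
  exact ⟨e, by simp [gandyHarrington, he]⟩

instance countable_computable {α β : Type*} [Primcodable α] [Primcodable β] :
    Countable {f : α → β // Computable f} := by
  choose c hc using fun f : {f : α → β // Computable f} =>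
    Nat.Partrec.Code.exists_code.1 (show Nat.Partrec _ from f.2)
  refine Function.Injective.countable (f := c) fun f g hfg => Subtype.ext (funext fun a => ?_)
  have h := (hc f).symm.trans ((congrArg _ hfg).trans (hc g))
  have h := congrFun h (Encodable.encode a)
  simpa using h

/-! ### Forests with rank labels -/

/-- A finite forest on `{0, …, len - 1}`, given by a parent function as in `HasBranch`, with labels
which are ordinals or `⊤` and strictly decrease from a node with ordinal label to its children. The
children of a node labelled `⊤` are not restricted. Values at arguments `≥ len` are meaningless. -/
structure ForestCond where
  parent : ℕ → ℕ
  rank : ℕ → WithTop Ordinal.{0}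
  len : ℕ
  rank_lt : ∀ j < len, parent j < j → rank j < rank (parent j) ∨ rank (parent j) = ⊤

/-- An infinite forest on `ℕ` with labels as in `ForestCond`. -/
structure RankedForest where
  parent : ℕ → ℕ
  rank : ℕ → WithTop Ordinal.{0}
  rank_lt : ∀ j, parent j < j → rank j < rank (parent j) ∨ rank (parent j) = ⊤

namespace ForestCond

/-- Stronger conditions are smaller. -/
instance : Preorder ForestCond where
  le r p := p.len ≤ r.len ∧ ∀ j < p.len, r.parent j = p.parent j ∧ r.rank j = p.rank j
  le_refl p := ⟨le_rfl, fun _ _ => ⟨rfl, rfl⟩⟩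
  le_trans r q p h k := ⟨k.1.trans h.1, fun j hj =>
    ⟨(h.2 j (hj.trans_le k.1)).1.trans (k.2 j hj).1,
      (h.2 j (hj.trans_le k.1)).2.trans (k.2 j hj).2⟩⟩

/-- Add one node, with label `⊤`. It is a child of `i` if `i < p.len`, and a root if `i = p.len`. -/
def snoc (p : ForestCond) (i : ℕ) (hi : i < p.len → p.rank i = ⊤) : ForestCond where
  parent := Function.update p.parent p.len i
  rank := Function.update p.rank p.len ⊤
  len := p.len + 1
  rank_lt j hj hlt := by
    rcases eq_or_ne j p.len with rfl | hne
    · simp only [Function.update_self] at hlt ⊢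
      exact Or.inr (by rw [Function.update_of_ne hlt.ne, hi hlt])
    · have hj' : j < p.len := by omega
      rw [Function.update_of_ne hne] at hlt ⊢
      rw [Function.update_of_ne hne, Function.update_of_ne (hlt.trans hj').ne]
      exact p.rank_lt j hj' hlt

theorem snoc_le (p : ForestCond) (i : ℕ) (hi : i < p.len → p.rank i = ⊤) : p.snoc i hi ≤ p :=
  ⟨Nat.le_succ _, fun j hj => by simp [snoc, hj.ne]⟩

theorem exists_le_le_len (p : ForestCond) (n : ℕ) : ∃ q ≤ p, n ≤ q.len := by
  induction n with
  | zero => exact ⟨p, le_rfl, Nat.zero_le _⟩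
  | succ n ih =>
    obtain ⟨q, hq, hn⟩ := ih
    exact ⟨q.snoc q.len (fun h => absurd h (lt_irrefl _)), (q.snoc_le _ _).trans hq,
      Nat.succ_le_succ hn⟩

end ForestCond

namespace RankedForest

/-- The finite part of a labelled forest with nodes `{0, …, n - 1}`. -/
def restrict (s : RankedForest) (n : ℕ) : ForestCond where
  parent := s.parent
  rank := s.rank
  len := n
  rank_lt j _ := s.rank_lt j

/-- The labelled forest `s` has the finite part `p`. -/
def Extends (s : RankedForest) (p : ForestCond) : Prop :=
  ∀ j < p.len, s.parent j = p.parent j ∧ s.rank j = p.rank j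

theorem extends_restrict (s : RankedForest) (n : ℕ) : s.Extends (s.restrict n) :=
  fun _ _ => ⟨rfl, rfl⟩

theorem Extends.mono {s : RankedForest} {p q : ForestCond} (h : s.Extends q) (hq : q ≤ p) :
    s.Extends p := fun j hj =>
  ⟨(h j (hj.trans_le hq.1)).1.trans (hq.2 j hj).1, (h j (hj.trans_le hq.1)).2.trans (hq.2 j hj).2⟩

theorem Extends.restrict_le {s : RankedForest} {p : ForestCond} (h : s.Extends p) {n : ℕ}
    (hn : p.len ≤ n) : s.restrict n ≤ p := ⟨hn, h⟩

/-- The Rasiowa–Sikorski lemma: countably many dense sets of conditions can be met. -/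
theorem exists_extends_forall_mem {ι : Type*} [Countable ι] [Nonempty ι] {D : ι → Set ForestCond}
    (hD : ∀ i p, ∃ q ≤ p, q ∈ D i) (p : ForestCond) :
    ∃ s : RankedForest, s.Extends p ∧ ∀ i, ∃ q ∈ D i, s.Extends q := by
  obtain ⟨f, hf⟩ := exists_surjective_nat ι
  have hstep : ∀ k (p : ForestCond), ∃ q, q ≤ p ∧ p.len < q.len ∧ ∃ d ∈ D (f k), q ≤ d := by
    intro k p
    obtain ⟨d, hdp, hd⟩ := hD (f k) p
    obtain ⟨q, hqd, hq⟩ := d.exists_le_le_len (p.len + 1)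
    exact ⟨q, hqd.trans hdp, hq, d, hd, hqd⟩
  choose next hle hlen hmem using hstep
  let P : ℕ → ForestCond := fun n => Nat.rec p next n
  have hP : ∀ k, P (k + 1) = next k (P k) := fun _ => rfl
  have hanti : Antitone P := antitone_nat_of_succ_le fun k => hle k (P k)
  have hlenP : ∀ k, k ≤ (P k).len := by
    intro k
    induction k with
    | zero => exact Nat.zero_le _
    | succ k ih => exact Nat.succ_le_of_lt (ih.trans_lt (hlen k (P k)))
  have hagree : ∀ k j, j < (P k).len →
      (P (j + 1)).parent j = (P k).parent j ∧ (P (j + 1)).rank j = (P k).rank j := by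
    intro k j hj
    rcases le_total k (j + 1) with h | h
    · exact (hanti h).2 j hj
    · have := (hanti h).2 j (hlenP (j + 1))
      exact ⟨this.1.symm, this.2.symm⟩
  let s : RankedForest :=
    { parent := fun j => (P (j + 1)).parent j
      rank := fun j => (P (j + 1)).rank j
      rank_lt := fun j hj => by
        have h := (P (j + 1)).rank_lt j (hlenP (j + 1)) hj
        rwa [← (hagree (j + 1) _ (hj.trans (hlenP (j + 1)))).2] at h }
  have hs : ∀ k, s.Extends (P k) := hagree
  refine ⟨s, hs 0, fun i => ?_⟩
  obtain ⟨k, rfl⟩ := hf i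
  obtain ⟨d, hd, hle⟩ := hmem k (P k)
  exact ⟨d, hd, (hs (k + 1)).mono hle⟩

theorem not_hasBranch (s : RankedForest) {n : ℕ} (hn : s.rank n ≠ ⊤) :
    ¬ HasBranch s.parent n := by
  rintro ⟨y, rfl, hy⟩
  have hlt : ∀ k, s.rank (y k) ≠ ⊤ → s.rank (y (k + 1)) < s.rank (y k) := fun k hk => by
    have := s.rank_lt (y (k + 1)) (by rw [(hy k).2]; exact (hy k).1)
    rw [(hy k).2] at this
    exact this.resolve_right hk
  have hne : ∀ k, s.rank (y k) ≠ ⊤ := fun k => by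
    induction k with
    | zero => exact hn
    | succ k ih => exact (hlt k ih).ne_top
  exact (RelEmbedding.natGT (r := (· < ·)) (fun k => s.rank (y k))
    fun k => hlt k (hne k)).not_wellFounded wellFounded_lt

end RankedForest

/-! ### Retagging -/

namespace ForestCond

open Ordinal

/-- Two conditions are similar up to `θ` if they have the same nodes and edges, and the same labels
as far as labels below `θ` are concerned. -/
def Sim (θ : Ordinal.{0}) (p q : ForestCond) : Prop :=
  p.len = q.len ∧ ∀ j < p.len, p.parent j = q.parent j ∧
    (p.rank j < θ ∨ q.rank j < θ → p.rank j = q.rank j)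

theorem Sim.refl (θ : Ordinal.{0}) (p : ForestCond) : Sim θ p p :=
  ⟨rfl, fun _ _ => ⟨rfl, fun _ => rfl⟩⟩

theorem Sim.symm {θ : Ordinal.{0}} {p q : ForestCond} (h : Sim θ p q) : Sim θ q p :=
  ⟨h.1.symm, fun j hj => ⟨(h.2 j (h.1 ▸ hj)).1.symm, fun k => ((h.2 j (h.1 ▸ hj)).2 k.symm).symm⟩⟩

theorem Sim.initSeg_parent_eq {θ : Ordinal.{0}} {p q : ForestCond} (h : Sim θ p q) {n : ℕ}
    (hn : n ≤ p.len) : initSeg p.parent n = initSeg q.parent n :=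
  initSeg_congr fun i hi => (h.2 i (hi.trans_le hn)).1

/-- The retagging lemma: similarity is a back-and-forth relation, at the cost of lowering the
bound by `ω`. Moreover the new nodes may be given ordinal labels. -/
theorem exists_le_sim {p q r : ForestCond} {θ θ' : Ordinal.{0}} (hθ : θ' + ω ≤ θ)
    (h : Sim θ p q) (hr : r ≤ q) :
    ∃ r' ≤ p, Sim θ' r' r ∧ ∀ j, p.len ≤ j → r'.rank j ≠ ⊤ := by
  obtain ⟨hlen, hpq⟩ := h
  have hθ' : θ' ≤ θ := le_self_add.trans hθ
  -- parents precede their children, so that `θ' + (r.len - j)` decreases from parents to children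
  let t : ℕ → WithTop Ordinal.{0} := fun j =>
    if j < p.len then p.rank j else min (r.rank j) ((θ' + (r.len - j : ℕ) : Ordinal.{0}))
  have ht : ∀ j < p.len, t j = p.rank j := fun j hj => if_pos hj
  have ht' : ∀ j, p.len ≤ j →
      t j = min (r.rank j) ((θ' + (r.len - j : ℕ) : Ordinal.{0})) := fun j hj => if_neg hj.not_gt
  refine ⟨⟨r.parent, t, r.len, fun j hj hlt => ?_⟩, ⟨?_, fun j hj => ?_⟩, ⟨rfl, fun j hj => ?_⟩,
    fun j hj => ?_⟩
  · rcases lt_or_ge j p.len with hjp | hjp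
    · have h1 : r.parent j = p.parent j :=
        (hr.2 j (hlen ▸ hjp)).1.trans (hpq j hjp).1.symm
      rw [h1] at hlt ⊢
      rw [ht j hjp, ht _ (hlt.trans hjp)]
      exact p.rank_lt j hjp hlt
    · rw [ht' j hjp]
      have hr' := r.rank_lt j hj hlt
      rcases lt_or_ge (r.parent j) p.len with hip | hip
      · rw [ht _ hip]
        have hq := (hr.2 _ (hlen ▸ hip)).2
        by_cases hsmall : p.rank (r.parent j) < θ
        · rw [hq, ← (hpq _ hip).2 (Or.inl hsmall)] at hr'
          exact hr'.imp_left (min_le_left _ _).trans_lt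
        · left
          refine (min_le_right _ _).trans_lt (lt_of_lt_of_le ?_ (not_lt.1 hsmall))
          refine WithTop.coe_lt_coe.2 (lt_of_lt_of_le ?_ hθ)
          exact add_lt_add_right (natCast_lt_omega0 _) θ'
      · left
        rw [ht' _ hip]
        have h2 : (θ' + (r.len - j : ℕ) : Ordinal.{0}) < θ' + (r.len - r.parent j : ℕ) :=
          add_lt_add_right (Nat.cast_lt.2 (by omega)) θ'
        refine lt_min ?_ ((min_le_right _ _).trans_lt (WithTop.coe_lt_coe.2 h2))
        rcases hr' with hr' | hr'
        · exact (min_le_left _ _).trans_lt hr'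
        · rw [hr']
          exact (min_le_right _ _).trans_lt (WithTop.coe_lt_top _)
  · exact hlen.trans_le hr.1
  · exact ⟨(hr.2 j (hlen ▸ hj)).1.trans (hpq j hj).1.symm, ht j hj⟩
  · refine ⟨rfl, fun hsmall => ?_⟩
    change t j < θ' ∨ r.rank j < θ' at hsmall
    change t j = r.rank j
    rcases lt_or_ge j p.len with hjp | hjp
    · rw [ht j hjp] at hsmall ⊢
      have hq := (hr.2 j (hlen ▸ hjp)).2
      rw [hq] at hsmall ⊢
      have hθ'' : (θ' : WithTop Ordinal.{0}) ≤ θ := WithTop.coe_le_coe.2 hθ'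
      exact (hpq j hjp).2 (hsmall.imp (fun h => h.trans_le hθ'') fun h => h.trans_le hθ'')
    · rw [ht' j hjp] at hsmall ⊢
      have h3 : (θ' : WithTop Ordinal.{0}) ≤ ((θ' + (r.len - j : ℕ) : Ordinal.{0})) :=
        WithTop.coe_le_coe.2 le_self_add
      refine min_eq_left (le_trans (le_of_lt ?_) h3)
      rcases hsmall with hs | hs
      · exact (min_lt_iff.1 hs).resolve_right h3.not_gt
      · exact hs
  · change t j ≠ ⊤
    rw [ht' j hj]
    exact ((min_le_right _ _).trans_lt (WithTop.coe_lt_top _)).ne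

/-- Replace all labels `≥ δ` by `⊤`. -/
noncomputable def collapse (p : ForestCond) (δ : Ordinal.{0}) : ForestCond where
  parent := p.parent
  rank j := if p.rank j < δ then p.rank j else ⊤
  len := p.len
  rank_lt j hj hlt := by
    by_cases h : p.rank (p.parent j) < δ
    · have h1 := (p.rank_lt j hj hlt).resolve_right (h.trans_le le_top).ne
      left
      rwa [if_pos h, if_pos (h1.trans h)]
    · exact Or.inr (if_neg h)

/-- All labels of the condition are below `δ` or `⊤`. -/
def BoundedBy (p : ForestCond) (δ : Ordinal.{0}) : Prop :=
  ∀ j < p.len, p.rank j < δ ∨ p.rank j = ⊤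

theorem BoundedBy.mono {p : ForestCond} {δ δ' : Ordinal.{0}} (h : p.BoundedBy δ) (hδ : δ ≤ δ') :
    p.BoundedBy δ' :=
  fun j hj => (h j hj).imp_left fun k => k.trans_le (WithTop.coe_le_coe.2 hδ)

theorem exists_boundedBy (p : ForestCond) : ∃ δ, p.BoundedBy δ := by
  refine ⟨(Finset.range p.len).sup (fun j => Order.succ ((p.rank j).untopD 0)), fun j hj => ?_⟩
  have h := Finset.le_sup (f := fun j => Order.succ ((p.rank j).untopD 0)) (Finset.mem_range.2 hj)
  rcases hr : p.rank j with _ | a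
  · exact Or.inr rfl
  · left
    simp only [hr] at h
    exact WithTop.coe_lt_coe.2 ((Order.lt_succ a).trans_le h)

theorem boundedBy_collapse (p : ForestCond) (δ : Ordinal.{0}) : (p.collapse δ).BoundedBy δ := by
  intro j _
  by_cases h : p.rank j < δ
  · exact Or.inl (by simp [collapse, h])
  · exact Or.inr (if_neg h)

theorem sim_collapse (p : ForestCond) (δ : Ordinal.{0}) : Sim δ p (p.collapse δ) := by
  refine ⟨rfl, fun j _ => ⟨rfl, fun h => ?_⟩⟩
  by_cases h' : p.rank j < δ
  · exact (if_pos h').symm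
  · simp [collapse, h'] at h

theorem collapse_le {p q r : ForestCond} {δ : Ordinal.{0}} (hp : p.BoundedBy δ) (h : Sim δ q p)
    (hr : r ≤ q) : r.collapse δ ≤ p := by
  refine ⟨h.1.symm.trans_le hr.1, fun j hj => ?_⟩
  have hj' : j < q.len := h.1 ▸ hj
  refine ⟨(hr.2 j hj').1.trans (h.2 j hj').1, ?_⟩
  change (if r.rank j < δ then r.rank j else ⊤) = p.rank j
  rw [(hr.2 j hj').2]
  split_ifs with hlt
  · exact (h.2 j hj').2 (Or.inl hlt)
  · refine ((hp j hj).resolve_left fun hlt' => hlt ?_).symm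
    rwa [(h.2 j hj').2 (Or.inr hlt')]

end ForestCond

/-! ### Forcing of `Π¹₁` statements -/

namespace ForestCond

open Ordinal

/-- The condition `r` forces that the tree of all `τ` extending `σ`, such that no pair of initial
segments of the generic point and of `τ`, of equal length `≥ σ.length`, is in `W`, is well-founded
of rank at most `γ`. Membership of `σ` in this tree is decided by every condition of length at least
`σ.length`. -/
def ForcesRankLE (W : Set (List ℕ × List ℕ)) (γ : Ordinal.{0}) (σ : List ℕ) (r : ForestCond) :
    Prop :=
  ∀ r' ≤ r, σ.length ≤ r'.len → (initSeg r'.parent σ.length, σ) ∉ W →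
    ∀ a : ℕ, ∃ r'' ≤ r', ∃ γ', ∃ _ : γ' < γ, ForcesRankLE W γ' (σ ++ [a]) r''
termination_by γ

theorem forcesRankLE_iff {W : Set (List ℕ × List ℕ)} {γ : Ordinal.{0}} {σ : List ℕ}
    {r : ForestCond} : ForcesRankLE W γ σ r ↔
      ∀ r' ≤ r, σ.length ≤ r'.len → (initSeg r'.parent σ.length, σ) ∉ W →
        ∀ a : ℕ, ∃ r'' ≤ r', ∃ γ' < γ, ForcesRankLE W γ' (σ ++ [a]) r'' := by
  rw [ForcesRankLE]
  simp only [exists_prop]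

/-- Whether a condition forces a rank `≤ γ` depends only on its labels below `simBound γ`. -/
noncomputable def simBound (γ : Ordinal.{0}) : Ordinal.{0} := ω * (2 * γ + 1)

theorem simBound_add_le {γ' γ : Ordinal.{0}} (h : γ' < γ) : simBound γ' + ω ≤ ω * (2 * γ) := by
  have h2 : (2 : Ordinal.{0}) * γ' + 1 + 1 ≤ 2 * γ := by
    rw [add_assoc, one_add_one_eq_two, ← mul_succ]
    exact mul_le_mul_right (Order.succ_le_of_lt h) 2
  calc simBound γ' + ω = ω * (2 * γ' + 1 + 1) := by rw [simBound, mul_add ω (2 * γ' + 1), mul_one]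
    _ ≤ ω * (2 * γ) := mul_le_mul_right h2 ω

theorem lt_simBound_add (γ : Ordinal.{0}) : γ < simBound γ + ω := by
  have h1 : γ ≤ 2 * γ := le_mul_right γ two_pos
  have h2 : 2 * γ + 1 ≤ simBound γ := le_mul_right _ omega0_pos
  calc γ ≤ 2 * γ := h1
    _ < 2 * γ + 1 := lt_add_of_pos_right _ one_pos
    _ ≤ simBound γ := h2
    _ ≤ simBound γ + ω := le_self_add

theorem ForcesRankLE.mono {W : Set (List ℕ × List ℕ)} {γ : Ordinal.{0}} {σ : List ℕ}
    {p q : ForestCond} (hp : ForcesRankLE W γ σ p) (hq : q ≤ p) : ForcesRankLE W γ σ q :=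
  forcesRankLE_iff.2 fun r hr => forcesRankLE_iff.1 hp r (hr.trans hq)

theorem ForcesRankLE.of_sim {W : Set (List ℕ × List ℕ)} {γ : Ordinal.{0}} {σ : List ℕ}
    {p q : ForestCond} (hp : ForcesRankLE W γ σ p) (h : Sim (simBound γ) p q) :
    ForcesRankLE W γ σ q := by
  induction γ using WellFoundedLT.induction generalizing σ p q with
  | ind γ ih =>
    rw [forcesRankLE_iff] at hp ⊢
    intro q₁ hq₁ hlen hσ a
    have hγ : ω * (2 * γ) + ω ≤ simBound γ := by rw [simBound, mul_add, mul_one]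
    obtain ⟨p₁, hp₁, hs₁, -⟩ := exists_le_sim hγ h hq₁
    obtain ⟨p₂, hp₂, γ', hγ', hf⟩ := hp p₁ hp₁ (hs₁.1 ▸ hlen)
      (by rwa [hs₁.initSeg_parent_eq (hs₁.1 ▸ hlen)]) a
    obtain ⟨q₂, hq₂, hs₂, -⟩ := exists_le_sim (simBound_add_le hγ') hs₁.symm hp₂
    exact ⟨q₂, hq₂, γ', hγ', ih γ' hγ' hf hs₂.symm⟩

/-- If some rank can be forced below the condition obtained from `q` by replacing all labels `≥ δ`
by `⊤`, then some rank can be forced below `q` itself, and even one below `δ`. -/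
def IsReflecting (W : ℕ → Set (List ℕ × List ℕ)) (δ : Ordinal.{0}) : Prop :=
  ∀ (q : ForestCond) (e : ℕ) (σ : List ℕ),
    (∃ r ≤ q.collapse δ, ∃ γ, ForcesRankLE (W e) γ σ r) →
      ∃ r ≤ q, ∃ γ < δ, ForcesRankLE (W e) γ σ r

/-- Reflecting ordinals are unbounded. Up to irrelevant values, there is only a set of conditions
with labels bounded by a given ordinal, so that it is possible to close off. -/
theorem exists_isReflecting (W : ℕ → Set (List ℕ × List ℕ)) (δ₀ : Ordinal.{0}) :
    ∃ δ ≥ δ₀, IsReflecting W δ := by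
  classical
  have hstep : ∀ δ : Ordinal.{0}, ∃ δ' ≥ δ, ∀ p : ForestCond, p.BoundedBy δ → ∀ e σ,
      (∃ r ≤ p, ∃ γ, ForcesRankLE (W e) γ σ r) →
        ∃ r ≤ p, ∃ γ, simBound γ + ω ≤ δ' ∧ ForcesRankLE (W e) γ σ r := by
    intro δ
    let I := ℕ × (ℕ → ℕ) × (ℕ → Set.Iio (Order.succ δ)) × ℕ × List ℕ
    let rk : Set.Iio (Order.succ δ) → WithTop Ordinal.{0} :=
      fun a => if a.1 < δ then (a.1 : WithTop Ordinal.{0}) else ⊤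
    let Q : I → Ordinal.{0} → Prop := fun i γ => ∃ r : ForestCond, (i.1 ≤ r.len ∧
      ∀ j < i.1, r.parent j = i.2.1 j ∧ r.rank j = rk (i.2.2.1 j)) ∧
        ForcesRankLE (W i.2.2.2.1) γ i.2.2.2.2 r
    let g : I → Ordinal.{0} := fun i =>
      if h : ∃ γ, Q i γ then simBound h.choose + ω else 0
    refine ⟨max δ (⨆ i, g i), le_max_left _ _, fun p hp e σ => ?_⟩
    rintro ⟨r, hr, γ, hγ⟩
    have hcode : ∀ j, ∃ a : Set.Iio (Order.succ δ), j < p.len → rk a = p.rank j := by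
      intro j
      by_cases hj : j < p.len
      · rcases hp j hj with h | h
        · obtain ⟨a, ha⟩ := WithTop.ne_top_iff_exists.1 (h.trans_le le_top).ne
          rw [← ha, WithTop.coe_lt_coe] at h
          exact ⟨⟨a, h.trans (Order.lt_succ δ)⟩, fun _ => by simp [rk, h, ← ha]⟩
        · exact ⟨⟨δ, Order.lt_succ δ⟩, fun _ => by simp [rk, h]⟩
      · exact ⟨⟨δ, Order.lt_succ δ⟩, fun h => absurd h hj⟩
    choose c hc using hcode
    have hle : ∀ r : ForestCond, (p.len ≤ r.len ∧
        ∀ j < p.len, r.parent j = p.parent j ∧ r.rank j = rk (c j)) ↔ r ≤ p := fun r =>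
      and_congr_right fun _ => forall₂_congr fun j hj => by rw [hc j hj]
    let i : I := (p.len, p.parent, c, e, σ)
    have hex : ∃ γ, Q i γ := ⟨γ, r, (hle r).2 hr, hγ⟩
    obtain ⟨r', hr', hf⟩ := hex.choose_spec
    refine ⟨r', (hle r').1 hr', hex.choose, ?_, hf⟩
    have hg : g i = simBound hex.choose + ω := dif_pos hex
    exact hg ▸ (Ordinal.le_iSup g i).trans (le_max_right _ _)
  choose next hnext hN using hstep
  let D : ℕ → Ordinal.{0} := fun n => Nat.rec δ₀ (fun _ => next) n
  have hmono : Monotone D := monotone_nat_of_le_succ fun n => hnext (D n)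
  have hDle : ∀ n, D n ≤ ⨆ n, D n := Ordinal.le_iSup D
  refine ⟨⨆ n, D n, hDle 0, fun q e σ => ?_⟩
  have hb := q.boundedBy_collapse (⨆ n, D n)
  obtain ⟨n, hn⟩ : ∃ n, (q.collapse (⨆ n, D n)).BoundedBy (D n) := by
    have h1 : ∀ j, ∃ n, j < (q.collapse (⨆ n, D n)).len →
        ((q.collapse (⨆ n, D n)).rank j < D n ∨ (q.collapse (⨆ n, D n)).rank j = ⊤) := by
      intro j
      by_cases hj : j < (q.collapse (⨆ n, D n)).len
      · rcases hb j hj with h | h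
        · obtain ⟨a, ha⟩ := WithTop.ne_top_iff_exists.1 (h.trans_le le_top).ne
          rw [← ha, WithTop.coe_lt_coe, Ordinal.lt_iSup_iff] at h
          obtain ⟨n, hn⟩ := h
          exact ⟨n, fun _ => Or.inl (by rw [← ha]; exact WithTop.coe_lt_coe.2 hn)⟩
        · exact ⟨0, fun _ => Or.inr h⟩
      · exact ⟨0, fun h => absurd h hj⟩
    choose m hm using h1
    refine ⟨(Finset.range (q.collapse (⨆ n, D n)).len).sup m, fun j hj => ?_⟩
    refine (hm j hj).imp_left fun h => h.trans_le (WithTop.coe_le_coe.2 (hmono ?_))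
    exact Finset.le_sup (Finset.mem_range.2 hj)
  intro hex
  obtain ⟨r, hr, γ, hγ, hf⟩ := hN (D n) _ hn e σ hex
  have hγ' : simBound γ + ω ≤ ⨆ n, D n := hγ.trans (hDle (n + 1))
  obtain ⟨r', hr', hs, -⟩ := exists_le_sim hγ' (q.sim_collapse _) hr
  exact ⟨r', hr', γ, (lt_simBound_add γ).trans_le hγ', hf.of_sim hs.symm⟩

/-- The recursive clause of `ForcesRankLE` with unspecified ranks. There is a proper class of
conditions `r' ≤ r`, so that a bound of the ranks is not immediate; but a reflecting ordinal above
the labels of `r` is one. -/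
theorem exists_forcesRankLE {W : Set (List ℕ × List ℕ)} {σ : List ℕ} {r : ForestCond}
    (h : ∀ r' ≤ r, σ.length ≤ r'.len → (initSeg r'.parent σ.length, σ) ∉ W →
      ∀ a : ℕ, ∃ r'' ≤ r', ∃ γ, ForcesRankLE W γ (σ ++ [a]) r'') :
    ∃ γ, ForcesRankLE W γ σ r := by
  obtain ⟨δ₀, hδ₀⟩ := r.exists_boundedBy
  obtain ⟨δ, hδ, hrefl⟩ := exists_isReflecting (fun _ => W) δ₀
  refine ⟨δ, forcesRankLE_iff.2 fun r' hr' hlen hσ a => ?_⟩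
  exact hrefl r' 0 (σ ++ [a])
    (h (r'.collapse δ) (collapse_le (hδ₀.mono hδ) (Sim.refl _ _) hr') hlen hσ a)

/-- No extension of `p` forces that the tree above `σ` is well-founded. -/
def NoRank (W : Set (List ℕ × List ℕ)) (σ : List ℕ) (p : ForestCond) : Prop :=
  ∀ r ≤ p, ∀ γ, ¬ ForcesRankLE W γ σ r

theorem NoRank.mono {W : Set (List ℕ × List ℕ)} {σ : List ℕ} {p q : ForestCond}
    (h : NoRank W σ p) (hq : q ≤ p) : NoRank W σ q := fun r hr => h r (hr.trans hq)

theorem NoRank.exists_append {W : Set (List ℕ × List ℕ)} {σ : List ℕ} {p : ForestCond}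
    (h : NoRank W σ p) : ∃ r ≤ p, (σ.length ≤ r.len ∧ (initSeg r.parent σ.length, σ) ∉ W) ∧
      ∃ a, NoRank W (σ ++ [a]) r := by
  by_contra! hcon
  obtain ⟨γ, hγ⟩ := exists_forcesRankLE (W := W) (σ := σ) (r := p) fun r hr hlen hσ a => by
    have := hcon r hr ⟨hlen, hσ⟩ a
    simpa only [NoRank, not_forall, not_not, exists_prop] using this
  exact h p le_rfl γ hγ

end ForestCond

/-! ### Generic forests -/

namespace RankedForest

open ForestCond

/-- A labelled forest is generic if it meets certain countably many dense sets: it decides whether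
the trees of attempts to show that its parent function is in one of the given `Σ¹₁` sets have ranks
and what the ranks are; if there is no rank, then it finds a one-step extension without rank; and
every node with label `⊤` has a child with this label. -/
structure IsGeneric (W : ℕ → Set (List ℕ × List ℕ)) (s : RankedForest) : Prop where
  decide : ∀ e σ, ∃ p, (NoRank (W e) σ p ∨ ∃ γ, ForcesRankLE (W e) γ σ p ∧
    ∀ r ≤ p, ∀ γ' < γ, ¬ ForcesRankLE (W e) γ' σ r) ∧ s.Extends p
  witness : ∀ e σ, ∃ p, ((∃ γ, ForcesRankLE (W e) γ σ p) ∨ (σ.length ≤ p.len ∧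
    (initSeg p.parent σ.length, σ) ∉ W e) ∧ ∃ a, NoRank (W e) (σ ++ [a]) p) ∧ s.Extends p
  child : ∀ j, ∃ p : ForestCond, (j < p.len ∧
    (p.rank j = ⊤ → ∃ k < p.len, j < k ∧ p.parent k = j ∧ p.rank k = ⊤)) ∧ s.Extends p

theorem dense_decide (W : Set (List ℕ × List ℕ)) (σ : List ℕ) (p : ForestCond) :
    ∃ q ≤ p, NoRank W σ q ∨ ∃ γ, ForcesRankLE W γ σ q ∧
      ∀ r ≤ q, ∀ γ' < γ, ¬ ForcesRankLE W γ' σ r := by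
  by_cases h : NoRank W σ p
  · exact ⟨p, le_rfl, Or.inl h⟩
  · simp only [NoRank, not_forall, not_not] at h
    obtain ⟨r, hr, γ, hγ⟩ := h
    obtain ⟨γ₀, ⟨q, hq, hγ₀⟩, hmin⟩ := WellFounded.has_min (wellFounded_lt (α := Ordinal.{0}))
      {γ | ∃ q ≤ p, ForcesRankLE W γ σ q} ⟨γ, r, hr, hγ⟩
    exact ⟨q, hq, Or.inr ⟨γ₀, hγ₀, fun r hr γ' hlt hf => hmin γ' ⟨r, hr.trans hq, hf⟩ hlt⟩⟩

theorem dense_child (j : ℕ) (p : ForestCond) : ∃ q ≤ p, j < q.len ∧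
    (q.rank j = ⊤ → ∃ k < q.len, j < k ∧ q.parent k = j ∧ q.rank k = ⊤) := by
  obtain ⟨q, hq, hj⟩ := p.exists_le_le_len (j + 1)
  by_cases h : q.rank j = ⊤
  · refine ⟨q.snoc j fun _ => h, (q.snoc_le j _).trans hq, hj.trans (Nat.le_succ _), fun _ => ?_⟩
    exact ⟨q.len, Nat.lt_succ_self _, hj, by simp [snoc], by simp [snoc]⟩
  · exact ⟨q, hq, hj, fun h' => absurd h' h⟩

/-- If a sequence of sets covers Baire space, then for one of them there are sufficiently many
generic forests with parent function in this set: they are dense below some condition. -/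
theorem exists_dense_isGeneric (W : ℕ → Set (List ℕ × List ℕ)) {ι : Type*} [Countable ι]
    {Z : ι → Set (ℕ → ℕ)} (hZ : ∀ x, ∃ i, x ∈ Z i) :
    ∃ i A, ∀ q ≤ A, ∃ s : RankedForest, s.Extends q ∧ IsGeneric W s ∧ s.parent ∈ Z i := by
  by_contra! hcon
  let D : (ℕ × List ℕ) ⊕ (ℕ × List ℕ) ⊕ ℕ ⊕ ι → Set ForestCond := fun
    | .inl (e, σ) => {p | NoRank (W e) σ p ∨ ∃ γ, ForcesRankLE (W e) γ σ p ∧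
        ∀ r ≤ p, ∀ γ' < γ, ¬ ForcesRankLE (W e) γ' σ r}
    | .inr (.inl (e, σ)) => {p | (∃ γ, ForcesRankLE (W e) γ σ p) ∨ (σ.length ≤ p.len ∧
        (initSeg p.parent σ.length, σ) ∉ W e) ∧ ∃ a, NoRank (W e) (σ ++ [a]) p}
    | .inr (.inr (.inl j)) => {p | j < p.len ∧
        (p.rank j = ⊤ → ∃ k < p.len, j < k ∧ p.parent k = j ∧ p.rank k = ⊤)}
    | .inr (.inr (.inr i)) => {p | ∀ s : RankedForest, s.Extends p → IsGeneric W s →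
        s.parent ∉ Z i}
  have hD : ∀ i p, ∃ q ≤ p, q ∈ D i := by
    rintro (⟨e, σ⟩ | ⟨e, σ⟩ | j | i) p
    · exact dense_decide (W e) σ p
    · by_cases h : NoRank (W e) σ p
      · obtain ⟨r, hr, h⟩ := h.exists_append
        exact ⟨r, hr, Or.inr h⟩
      · simp only [NoRank, not_forall, not_not] at h
        obtain ⟨r, hr, h⟩ := h
        exact ⟨r, hr, Or.inl h⟩
    · exact dense_child j p
    · exact hcon i p
  let p₀ : ForestCond := ⟨id, fun _ => ⊤, 0, fun _ h => absurd h (Nat.not_lt_zero _)⟩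
  obtain ⟨s, -, hs⟩ := exists_extends_forall_mem hD p₀
  have hgen : IsGeneric W s :=
    ⟨fun e σ => hs (.inl (e, σ)), fun e σ => hs (.inr (.inl (e, σ))),
      fun j => hs (.inr (.inr (.inl j)))⟩
  obtain ⟨i, hi⟩ := hZ s.parent
  obtain ⟨p, hp, hsp⟩ := hs (.inr (.inr (.inr i)))
  exact hp s hsp hgen hi

theorem IsGeneric.hasBranch {W : ℕ → Set (List ℕ × List ℕ)} {s : RankedForest}
    (hs : IsGeneric W s) {n : ℕ} (hn : s.rank n = ⊤) : HasBranch s.parent n := by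
  have hstep : ∀ j : {j // s.rank j = ⊤}, ∃ k : {k // s.rank k = ⊤},
      j.1 < k.1 ∧ s.parent k.1 = j.1 := by
    rintro ⟨j, hj⟩
    obtain ⟨p, ⟨hjp, hp⟩, hsp⟩ := hs.child j
    obtain ⟨k, hk, hjk, hpar, hrank⟩ := hp ((hsp j hjp).2 ▸ hj)
    exact ⟨⟨k, (hsp k hk).2.trans hrank⟩, hjk, (hsp k hk).1.trans hpar⟩
  choose next hlt hpar using hstep
  let y : ℕ → {j // s.rank j = ⊤} := fun m => Nat.rec ⟨n, hn⟩ (fun _ => next) m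
  exact ⟨fun m => (y m).1, rfl, fun m => ⟨hlt (y m), hpar (y m)⟩⟩

theorem initSeg_eq_of_extends {s : RankedForest} {p : ForestCond} (h : s.Extends p) {n : ℕ}
    (hn : n ≤ p.len) : initSeg s.parent n = initSeg p.parent n :=
  initSeg_congr fun i hi => (h i (hi.trans_le hn)).1

/-- The truth lemma for `Σ¹₁` sets. -/
theorem IsGeneric.exists_branch_iff {W : ℕ → Set (List ℕ × List ℕ)} {s : RankedForest}
    (hs : IsGeneric W s) (e : ℕ) :
    (∃ y : ℕ → ℕ, ∀ n, (initSeg s.parent n, initSeg y n) ∉ W e) ↔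
      ∃ p, s.Extends p ∧ NoRank (W e) [] p := by
  constructor
  · rintro ⟨y, hy⟩
    by_contra! hcon
    -- the ranks of the initial segments of a branch would be a decreasing sequence of ordinals
    have key : ∀ γ n p, s.Extends p → ¬ ForcesRankLE (W e) γ (initSeg y n) p := by
      intro γ
      induction γ using WellFoundedLT.induction with
      | ind γ ih =>
        intro n p hp hf
        obtain ⟨d, hd, hsd⟩ := hs.decide e (initSeg y (n + 1))
        have hr := s.extends_restrict (max n (max p.len d.len))
        have hrp := hp.restrict_le (n := max n (max p.len d.len)) (by omega)
        have hrd := hsd.restrict_le (n := max n (max p.len d.len)) (by omega)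
        obtain ⟨r, hr, γ', hγ', hf'⟩ := forcesRankLE_iff.1 hf _ hrp
          (by rw [length_initSeg]; exact le_max_left _ _)
          (by rw [length_initSeg]; exact hy n) (y n)
        rw [← initSeg_succ] at hf'
        rcases hd with hd | ⟨γ₁, hγ₁, hmin⟩
        · exact hd r (hr.trans hrd) γ' hf'
        · have hle : γ₁ ≤ γ' := not_lt.1 fun hlt => hmin r (hr.trans hrd) γ' hlt hf'
          exact ih γ₁ (hle.trans_lt hγ') (n + 1) d hsd hγ₁
    obtain ⟨d, hd, hsd⟩ := hs.decide e []
    rcases hd with hd | ⟨γ, hγ, -⟩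
    · exact hcon d hsd hd
    · exact key γ 0 d hsd hγ
  · intro h0
    have hstep : ∀ σ, (∃ p, s.Extends p ∧ NoRank (W e) σ p) →
        (initSeg s.parent σ.length, σ) ∉ W e ∧
          ∃ a, ∃ p, s.Extends p ∧ NoRank (W e) (σ ++ [a]) p := by
      rintro σ ⟨p, hsp, hp⟩
      obtain ⟨d, hd, hsd⟩ := hs.witness e σ
      rcases hd with ⟨γ, hγ⟩ | ⟨⟨hlen, hσ⟩, a, ha⟩
      · have hrp := hsp.restrict_le (le_max_left p.len d.len)
        have hrd := hsd.restrict_le (le_max_right p.len d.len)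
        exact absurd (hγ.mono hrd) (hp _ hrp γ)
      · exact ⟨by rwa [initSeg_eq_of_extends hsd hlen], a, d, hsd, ha⟩
    choose! hW next hnext using hstep
    let τ : ℕ → List ℕ := fun n => Nat.rec [] (fun _ σ => σ ++ [next σ]) n
    have hτ : ∀ n, ∃ p, s.Extends p ∧ NoRank (W e) (τ n) p := fun n => by
      induction n with
      | zero => exact h0
      | succ n ih => exact hnext _ ih
    have hy : ∀ n, initSeg (fun n => next (τ n)) n = τ n := fun n => by
      induction n with
      | zero => rfl
      | succ n ih => rw [initSeg_succ, ih]
    refine ⟨fun n => next (τ n), fun n => ?_⟩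
    have h := hW _ (hτ n)
    rwa [← hy n, length_initSeg] at h

end RankedForest

/-! ### Covers of the Gandy-Harrington space -/

open ForestCond RankedForest in
/-- The Gandy-Harrington space is not covered by countably many regular subspaces: in every
countable cover there are a set `Z`, a point `x ∈ Z` and a subbasic open set containing `x` which
does not include the closure in `Z` of any neighborhood of `x`. -/
theorem exists_forall_closure_not_subset_gandyHarrington {ι : Type*} [Countable ι]
    {Z : ι → Set (ℕ → ℕ)} (hZ : ∀ x, ∃ i, x ∈ Z i) :
    ∃ i, ∃ x ∈ Z i, ∃ e, x ∈ gandyHarrington e ∧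
      ∀ F : Finset ℕ, (∀ d ∈ F, x ∈ gandyHarrington d) →
        ∃ y ∈ Z i, (∀ F' : Finset ℕ, (∀ d ∈ F', y ∈ gandyHarrington d) →
          ∃ w ∈ Z i, (∀ d ∈ F, w ∈ gandyHarrington d) ∧ ∀ d ∈ F', w ∈ gandyHarrington d) ∧
        y ∉ gandyHarrington e := by
  obtain ⟨i, A, hA⟩ := exists_dense_isGeneric cePairs hZ
  -- finitely many basic neighborhoods of a generic point are forced by a single condition
  have hforce : ∀ {s : RankedForest} {p : ForestCond} (F : Finset ℕ), IsGeneric cePairs s →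
      s.Extends p → (∀ d ∈ F, s.parent ∈ gandyHarrington d) →
        ∃ q ≤ p, s.Extends q ∧ ∀ d ∈ F, NoRank (cePairs d) [] q := by
    intro s p F hs hp hF
    have : Nonempty ForestCond := ⟨p⟩
    choose! q hsq hq using fun d hd => (hs.exists_branch_iff d).1 (hF d hd)
    refine ⟨s.restrict (max p.len (F.sup fun d => (q d).len)), hp.restrict_le (le_max_left _ _),
      s.extends_restrict _, fun d hd => (hq d hd).mono ((hsq d hd).restrict_le ?_)⟩
    exact (Finset.le_sup (f := fun d => (q d).len) hd).trans (le_max_right _ _)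
  obtain ⟨e, he⟩ := exists_gandyHarrington_eq_hasBranch A.len
  -- `x` is the parent function of a forest in which the first node not mentioned by `A` has
  -- label `⊤`, and `y` will be that of a similar forest in which this label is an ordinal
  have hroot : A.len < A.len → A.rank A.len = ⊤ := fun h => absurd h (lt_irrefl _)
  obtain ⟨s, hs₁, hs, hsZ⟩ := hA (A.snoc A.len hroot) (A.snoc_le _ _)
  have hsA : s.rank A.len = ⊤ := by
    have := (hs₁ A.len (Nat.lt_succ_self _)).2
    simpa [snoc] using this
  refine ⟨i, s.parent, hsZ, e, he ▸ hs.hasBranch hsA, fun F hF => ?_⟩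
  obtain ⟨p, hpA, hsp, hpF⟩ := hforce F hs hs₁ hF
  have hpA' : p ≤ A := hpA.trans (A.snoc_le _ _)
  obtain ⟨δ₀, hδ₀⟩ := p.exists_boundedBy
  obtain ⟨δ, hδ, hrefl⟩ := exists_isReflecting cePairs δ₀
  have hpδ := hδ₀.mono hδ
  obtain ⟨p', hp'A, hsim, htop⟩ :=
    exists_le_sim (le_refl (δ + Ordinal.omega0)) (Sim.refl _ A) hpA'
  obtain ⟨t, htp', ht, htZ⟩ := hA p' hp'A
  have hlt : A.len < p'.len := hsim.1 ▸ (Nat.lt_succ_self A.len).trans_le hpA.1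
  have htA : t.rank A.len ≠ ⊤ := by
    rw [(htp' _ hlt).2]
    exact htop _ le_rfl
  refine ⟨t.parent, htZ, fun F' hF' => ?_, he ▸ t.not_hasBranch htA⟩
  obtain ⟨q, hqp', -, hqF'⟩ := hforce F' ht htp' hF'
  have hqp : q.collapse δ ≤ p := collapse_le hpδ hsim hqp'
  obtain ⟨u, hu₁, hu, huZ⟩ := hA (q.collapse δ) (hqp.trans hpA')
  refine ⟨u.parent, huZ, fun d hd => ?_, fun d hd => ?_⟩
  · exact (hu.exists_branch_iff d).2 ⟨p, hu₁.mono hqp, hpF d hd⟩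
  · refine (hu.exists_branch_iff d).2 ⟨q.collapse δ, hu₁, fun r hr γ hf => ?_⟩
    obtain ⟨r', hr', γ', -, hf'⟩ := hrefl q d [] ⟨r, hr, γ, hf⟩
    exact hqF' d hd r' hr' γ' hf'

theorem mainTheorem6 {X : Type*} [TopologicalSpace X] [T2Space X] [RegularSpace X]
    (N : ℕ → Set X) (hN : IsCsNetwork (Set.range N)) :
    ∃ d ∈ pointDegrees (basisNames gandyHarrington), d ∉ pointDegrees (networkNames N) := by
  by_contra! hcon
  let M := {f : {f : List ℕ → List ℕ // Computable f} // ∀ σ τ, σ <+: τ → f.1 σ <+: f.1 τ}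
  let Z : M × M → Set (ℕ → ℕ) := fun v => matchedPoints gandyHarrington N v.1.1.1 v.2.1.1
  have hZ : ∀ x, ∃ v, x ∈ Z v := by
    intro x
    obtain ⟨z, hz⟩ := hcon _ ⟨x, rfl⟩
    obtain ⟨⟨φ, hφ, mφ, h⟩, ψ, hψ, mψ, h'⟩ := Quotient.exact hz
    exact ⟨(⟨⟨φ, hφ⟩, mφ⟩, ⟨⟨ψ, hψ⟩, mψ⟩), z, h, h'⟩
  have hβ : ∀ x, ∃ e, x ∈ gandyHarrington e := fun x =>
    exists_gandyHarrington_eq_univ.imp fun e (he : gandyHarrington e = _) => he ▸ Set.mem_univ x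
  obtain ⟨v, x, hx, e, hxe, h⟩ := exists_forall_closure_not_subset_gandyHarrington hZ
  obtain ⟨F, hF, hcl⟩ :=
    exists_finset_closure_subset_of_matchedPoints hβ hN v.1.2 v.2.2 hx hxe
  obtain ⟨y, hy, hyF, hye⟩ := h F hF
  exact hye (hcl y hy hyF)
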